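/- There is an absolute constant $r_0>1$ such that for every integer $n\ge 3$ there exist a smooth Riemannian metric $g$ on $\mathbb R^n$, a smooth function $u:\mathbb R^n\to(0,\infty)$ and a smooth function $\zeta$ with the following properties. Write $r=|x|$, $v(r)=(r\ln r)^{-\frac{n-2}{2}}$ for $r>1$, and $v_0=v(r_0)$. 1. $g=u^{\frac{4}{n-2}}g_{euc}$, where $g_{euc}$ is the Euclidean metric; in particular $g$ is conformally flat. 2. $\zeta$ maps $[0,\infty)$ into $[0,v_0/2]$, $\zeta(t)=t$ for $t\ge 0$ near $0$, $\zeta$ is constant on $[v_0/2,\infty)$, and $\zeta'\ge 0$, $\zeta''\le 0$ on $[0,\infty)$. Moreover $u(x)=\zeta(v(|x|))$ for $|x|\ge r_0$, and $u$ is constant, equal to $\zeta(v_0)$, on the ball $\{|x|\le r_0\}$. 3. $(\mathbb R^n,g)$ is complete, its scalar curvature is nonnegative everywhere, and its total volume is finite. In particular, $\liminf_{r\to\infty}\mathrm{vol}_g(B_r(p))/r=0$ for all $p\in\mathbb R^n$, where $B_r(p)$ is the geodesic ball of $g$; so completeness, non-compactness and nonnegative scalar curvature alone do not imply at least linear volume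 growth. -/

import Mathlib

open scoped Manifold ContDiff Bundle InnerProductSpace
open MeasureTheory Filter

namespace FiniteVolume

noncomputable section

/-- Euclidean space `ℝⁿ`. -/
abbrev E (n : ℕ) : Type := EuclideanSpace ℝ (Fin n)

/-- Smooth (`C^∞`) Riemannian metrics on `ℝⁿ`, as sections of the bundle of bilinear forms on the
tangent bundle. -/
abbrev Metric (n : ℕ) : Type :=
  Bundle.ContMDiffRiemannianMetric 𝓘(ℝ, E n) ∞ (E n) (fun x : E n ↦ TangentSpace 𝓘(ℝ, E n) x)

/-- The value `g_x(v, w)` on vectors of `ℝⁿ`, through the identification `T_xℝⁿ = ℝⁿ`. -/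
def Metric.form {n : ℕ} (g : Metric n) (x v w : E n) : ℝ :=
  g.inner x (v : TangentSpace 𝓘(ℝ, E n) x) (w : TangentSpace 𝓘(ℝ, E n) x)

/-- The standard basis vector `e_i`, that is, the coordinate vector field `∂_i`. -/
def coordVec {n : ℕ} (i : Fin n) : E n := EuclideanSpace.single i 1

/-- The partial derivative `∂_i f` at `x`. -/
def pd {n : ℕ} (i : Fin n) (f : E n → ℝ) (x : E n) : ℝ := fderiv ℝ f x (coordVec i)

/-- The matrix `(g_ij(x))` of the metric in the standard coordinates. -/
def Metric.gram {n : ℕ} (g : Metric n) (x : E n) : Matrix (Fin n) (Fin n) ℝ :=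
  Matrix.of fun i j ↦ g.form x (coordVec i) (coordVec j)

/-- The Christoffel symbols of the Levi-Civita connection,
`Γ^k_ij = (1/2) ∑_l g^{kl} (∂_i g_jl + ∂_j g_il - ∂_l g_ij)`. -/
def Metric.christoffel {n : ℕ} (g : Metric n) (k i j : Fin n) (x : E n) : ℝ :=
  (1 / 2) * ∑ l, (g.gram x)⁻¹ k l *
    (pd i (fun y ↦ g.gram y j l) x + pd j (fun y ↦ g.gram y i l) x - pd l (fun y ↦ g.gram y i j) x)

/-- The components of the curvature tensor `R(∂_i, ∂_j)∂_k = ∑_l R^l_{kij} ∂_l`, where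
`R(X, Y)Z = ∇_X ∇_Y Z - ∇_Y ∇_X Z - ∇_{[X, Y]} Z`. -/
def Metric.riemann {n : ℕ} (g : Metric n) (l k i j : Fin n) (x : E n) : ℝ :=
  pd i (g.christoffel l j k) x - pd j (g.christoffel l i k) x
    + ∑ m, (g.christoffel l i m x * g.christoffel m j k x
      - g.christoffel l j m x * g.christoffel m i k x)

/-- The Ricci tensor `Ric(∂_j, ∂_k) = tr (X ↦ R(X, ∂_j)∂_k)`. -/
def Metric.ricci {n : ℕ} (g : Metric n) (j k : Fin n) (x : E n) : ℝ :=
  ∑ l, g.riemann l k l j x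

/-- The scalar curvature `R(g) = ∑_{j,k} g^{jk} Ric_jk`. -/
def Metric.scalarCurvature {n : ℕ} (g : Metric n) (x : E n) : ℝ :=
  ∑ j, ∑ k, (g.gram x)⁻¹ j k * g.ricci j k x

/-- The Riemannian volume measure `√(det g_ij) dx`. -/
def Metric.vol {n : ℕ} (g : Metric n) : Measure (E n) :=
  (volume : Measure (E n)).withDensity fun x ↦ ENNReal.ofReal (Real.sqrt (g.gram x).det)

/-- The Riemannian distance of `g` (infimum of `g`-lengths of `C^1` paths), as an extended
pseudometric on `ℝⁿ`. -/
@[reducible]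
def Metric.distSpace {n : ℕ} (g : Metric n) : PseudoEMetricSpace (E n) :=
  letI : Bundle.RiemannianBundle (fun x : E n ↦ TangentSpace 𝓘(ℝ, E n) x) :=
    ⟨g.toRiemannianMetric⟩
  haveI : IsContinuousRiemannianBundle (E n) (fun x : E n ↦ TangentSpace 𝓘(ℝ, E n) x) :=
    ⟨g.inner, g.contMDiff.continuous, fun _ _ _ ↦ rfl⟩
  PseudoEMetricSpace.ofRiemannianMetric 𝓘(ℝ, E n) (E n)

/-- `(ℝⁿ, g)` is complete: `ℝⁿ` with the Riemannian distance of `g` is a complete metric space. -/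
def Metric.IsComplete {n : ℕ} (g : Metric n) : Prop :=
  @CompleteSpace (E n) g.distSpace.toUniformSpace

/-- The open geodesic ball `B_r(p)` of `g`. -/
def Metric.geodBall {n : ℕ} (g : Metric n) (p : E n) (r : ℝ) : Set (E n) :=
  {y | g.distSpace.edist y p < ENNReal.ofReal r}

/-- `g = u^{4/(n-2)} g_euc`. -/
def Metric.IsConformalToEuclidean {n : ℕ} (g : Metric n) (u : E n → ℝ) : Prop :=
  ∀ x v w : E n, g.form x v w = u x ^ (4 / ((n : ℝ) - 2)) * ⟪v, w⟫_ℝ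

/-- The radial profile `(r ln r)^{-(n-2)/2}`, for `r > 1`. -/
def profile (n : ℕ) (r : ℝ) : ℝ := (r * Real.log r) ^ (-(((n : ℝ) - 2) / 2))

/-- Smooth nondecreasing concave truncations `ζ : [0, ∞) → [0, a]`: the identity near `0` and
constant on `[a, ∞)`. -/
structure IsTruncation (a : ℝ) (ζ : ℝ → ℝ) : Prop where
  smooth : ContDiff ℝ ∞ ζ
  mem_Icc : ∀ t, 0 ≤ t → ζ t ∈ Set.Icc 0 a
  eq_self : ∃ ε > 0, ∀ t ∈ Set.Icc 0 ε, ζ t = t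
  eq_const : ∃ c, ∀ t, a ≤ t → ζ t = c
  deriv_nonneg : ∀ t, 0 ≤ t → 0 ≤ deriv ζ t
  deriv2_nonpos : ∀ t, 0 ≤ t → deriv (deriv ζ) t ≤ 0

end

end FiniteVolume

/-! Write `g = e^{2φ} g_euc` with `φ = (2/(n-2)) log u`. In the scalar curvature of `g` the gradient
terms cancel and a negative multiple of `Δu / u` remains, so nonnegativity means that `u` is
superharmonic. The profile `v` is superharmonic once `log r ≥ 2` (`laplacian_squareProfile_nonpos`).
Composing with a nondecreasing concave `ζ` preserves this, and flatness of `ζ` above `v₀/2` lets `u`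
be constant on the ball.

Near infinity `u = v`, so lengths scale by `v^{2/(n-2)} = 1/(r log r)`. Its radial integral diverges
like `log log r`, which gives completeness: `c * log log (3 + |x|²)` is proper and 1-Lipschitz for
`g`. The volume density in polar coordinates is a multiple of `r^{n-1} (r log r)^{-n} = 1/(r log^n
r)`, which is integrable. Finite volume then forces `vol(B_r)/r → 0`. -/

namespace FiniteVolume

noncomputable section

/-! ### Conformally flat metrics. -/

set_option synthInstance.maxHeartbeats 400000 in
set_option maxHeartbeats 1000000 in
/-- The conformally flat metric `e^{2φ} g_euc`. -/
def conformalMetric {n : ℕ} (φ : E n → ℝ) (hφ : ContDiff ℝ ∞ φ) : Metric n where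
  inner x := Real.exp (2 * φ x) • (riemannianMetricVectorSpace (E n)).inner x
  symm x v w :=
    congrArg (Real.exp (2 * φ x) * ·) (real_inner_comm (F := E n) w v)
  pos x v hv := mul_pos (Real.exp_pos _) ((real_inner_self_pos (F := E n)).2 hv)
  isVonNBounded x := by
    change Bornology.IsVonNBounded ℝ {v : E n | Real.exp (2 * φ x) * inner ℝ v v < 1}
    refine (NormedSpace.isVonNBounded_ball ℝ (E n) (Real.exp (-φ x))).subset fun v hv ↦ ?_
    have hv : Real.exp (2 * φ x) * inner ℝ v v < 1 := hv
    rw [mem_ball_zero_iff]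
    rw [real_inner_self_eq_norm_sq, two_mul, Real.exp_add] at hv
    rw [Real.exp_neg, ← one_div, lt_div_iff₀ (Real.exp_pos _)]
    refine lt_of_pow_lt_pow_left₀ 2 zero_le_one ?_
    linarith [mul_pow ‖v‖ (Real.exp (φ x)) 2]
  contMDiff := by
    have h1 : ContMDiff 𝓘(ℝ, E n) 𝓘(ℝ) ∞ (fun x ↦ Real.exp (2 * φ x)) :=
      (contDiff_const.mul hφ).exp.contMDiff
    exact h1.smul_section ((riemannianMetricVectorSpace (E n)).contMDiff.of_le le_top)

theorem conformalMetric_form {n : ℕ} (φ : E n → ℝ) (hφ : ContDiff ℝ ∞ φ) (x v w : E n) :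
    (conformalMetric φ hφ).form x v w = Real.exp (2 * φ x) * ⟪v, w⟫_ℝ := rfl

/-! ### Completeness from a proper 1-Lipschitz function. -/

theorem exists_path_of_edist_lt {n : ℕ} {g : Metric n} {x y : E n} {c : ENNReal}
    (h : g.distSpace.edist x y < c) :
    ∃ γ : ℝ → E n, γ 0 = x ∧ γ 1 = y ∧ ContDiffOn ℝ 1 γ (Set.Icc 0 1) ∧
      ∫⁻ t in Set.Icc 0 1, ENNReal.ofReal (√(g.form (γ t) (derivWithin γ (Set.Icc 0 1) t)
        (derivWithin γ (Set.Icc 0 1) t))) < c := by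
  let : Bundle.RiemannianBundle (fun x : E n ↦ TangentSpace 𝓘(ℝ, E n) x) :=
    ⟨g.toRiemannianMetric⟩
  have : IsContinuousRiemannianBundle (E n) (fun x : E n ↦ TangentSpace 𝓘(ℝ, E n) x) :=
    ⟨g.inner, g.contMDiff.continuous, fun _ _ _ ↦ rfl⟩
  change Manifold.riemannianEDist 𝓘(ℝ, E n) x y < c at h
  obtain ⟨γ, h0, h1, hγ, hl⟩ := Manifold.exists_lt_of_riemannianEDist_lt h
  refine ⟨γ, h0, h1, contMDiffOn_iff_contDiffOn.1 hγ, lt_of_eq_of_lt ?_ hl⟩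
  rw [Manifold.pathELength_eq_lintegral_mfderivWithin_Icc]
  refine setLIntegral_congr_fun measurableSet_Icc fun t ht ↦ ?_
  rw [← ofReal_norm, norm_eq_sqrt_real_inner,
    mfderivWithin_eq_fderivWithin]
  rfl

/-- A Cauchy filter contains a set of diameter less than 1, hence lives in the unit ball about any
point of it, and so in a compact set. -/
theorem completeSpace_of_isCompact_of_edist_lt_one {X : Type*} [PseudoEMetricSpace X]
    (h : ∀ p : X, ∃ K, IsCompact K ∧ ∀ y, edist p y < 1 → y ∈ K) : CompleteSpace X := by
  refine ⟨fun {f} hf ↦ ?_⟩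
  obtain ⟨t, ht, htd⟩ := (EMetric.cauchy_iff.1 hf).2 1 one_pos
  obtain ⟨p, hp⟩ := hf.1.nonempty_of_mem ht
  obtain ⟨K, hK, hsub⟩ := h p
  obtain ⟨z, -, hz⟩ := hK.isComplete f hf
    (le_principal_iff.2 (mem_of_superset ht fun y hy ↦ hsub y (htd p hp y hy)))
  exact ⟨z, hz⟩

/-- Integrating the gradient bound along paths makes `ψ` 1-Lipschitz for the distance of `g`, so
unit balls lie in sublevel sets of `ψ`, which are bounded. -/
theorem isComplete_of_proper {n : ℕ} {g : Metric n} (ψ : E n → ℝ) (hψ : ContDiff ℝ 1 ψ)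
    (hle : ∀ x v, |fderiv ℝ ψ x v| ≤ √(g.form x v v))
    (hproper : ∀ C : ℝ, ∃ R : ℝ, ∀ x, ψ x ≤ C → ‖x‖ ≤ R) : g.IsComplete := by
  have key : ∀ x y, ENNReal.ofReal (|ψ y - ψ x|) ≤ g.distSpace.edist x y := by
    intro x y
    refine le_of_forall_gt fun c hc ↦ ?_
    obtain ⟨γ, h0, h1, hγ, hl⟩ := exists_path_of_edist_lt hc
    refine lt_of_le_of_lt ?_ hl
    have := enorm_sub_le_lintegral_derivWithin_Icc_of_contDiffOn_Icc
      (hψ.comp_contDiffOn hγ) zero_le_one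
    simp only [Function.comp, h0, h1] at this
    rw [Real.enorm_eq_ofReal_abs] at this
    refine this.trans (setLIntegral_mono' measurableSet_Icc fun t ht ↦ ?_)
    rw [Real.enorm_eq_ofReal_abs]
    refine ENNReal.ofReal_le_ofReal ?_
    have hd : HasDerivWithinAt (ψ ∘ γ)
        (fderiv ℝ ψ (γ t) (derivWithin γ (Set.Icc 0 1) t)) (Set.Icc 0 1) t :=
      ((hψ.differentiable one_ne_zero).differentiableAt.hasFDerivAt).comp_hasDerivWithinAt t
        ((hγ.differentiableOn one_ne_zero) t ht).hasDerivWithinAt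
    rw [hd.derivWithin (uniqueDiffOn_Icc zero_lt_one t ht)]
    exact hle _ _
  refine @completeSpace_of_isCompact_of_edist_lt_one (E n) g.distSpace fun p ↦ ?_
  obtain ⟨R, hR⟩ := hproper (ψ p + 1)
  -- The topology of `g.distSpace` is by construction the Euclidean one, so Euclidean closed balls
  -- are compact for it.
  refine ⟨Metric.closedBall 0 R, isCompact_closedBall _ _, fun y hy ↦ ?_⟩
  rw [mem_closedBall_zero_iff]
  apply hR
  have h1 := (key p y).trans_lt hy
  rw [ENNReal.ofReal_lt_one] at h1
  linarith [le_abs_self (ψ y - ψ p)]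

/-! ### Scalar curvature of a conformally flat metric. -/

theorem inner_coordVec {n : ℕ} (i j : Fin n) :
    ⟪coordVec i, coordVec j⟫_ℝ = if i = j then 1 else 0 := by
  simp [coordVec, EuclideanSpace.inner_single_left]

theorem contDiff_pd {n : ℕ} {f : E n → ℝ} (hf : ContDiff ℝ ∞ f) (i : Fin n) :
    ContDiff ℝ ∞ (pd i f) :=
  (hf.fderiv_right (m := ∞) (by simp)).clm_apply contDiff_const

theorem pd_of_hasFDerivAt {n : ℕ} {f : E n → ℝ} {f' : E n →L[ℝ] ℝ} {x : E n} (i : Fin n)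
    (h : HasFDerivAt f f' x) : pd i f x = f' (coordVec i) := by
  rw [pd, h.fderiv]

theorem gram_conformalMetric {n : ℕ} (φ : E n → ℝ) (hφ : ContDiff ℝ ∞ φ) (x : E n) :
    (conformalMetric φ hφ).gram x = Real.exp (2 * φ x) • (1 : Matrix (Fin n) (Fin n) ℝ) := by
  ext i j
  simp [Metric.gram, conformalMetric_form, inner_coordVec, Matrix.one_apply]

theorem inv_gram_conformalMetric {n : ℕ} (φ : E n → ℝ) (hφ : ContDiff ℝ ∞ φ) (x : E n) :
    ((conformalMetric φ hφ).gram x)⁻¹ =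
      Real.exp (-(2 * φ x)) • (1 : Matrix (Fin n) (Fin n) ℝ) := by
  rw [gram_conformalMetric]
  refine Matrix.inv_eq_left_inv ?_
  rw [Matrix.smul_mul, Matrix.one_mul, smul_smul, ← Real.exp_add, neg_add_cancel, Real.exp_zero,
    one_smul]

theorem pd_gram_conformalMetric {n : ℕ} (φ : E n → ℝ) (hφ : ContDiff ℝ ∞ φ) (x : E n)
    (i j l : Fin n) :
    pd i (fun y ↦ (conformalMetric φ hφ).gram y j l) x =
      (if j = l then 1 else 0) * (2 * Real.exp (2 * φ x) * pd i φ x) := by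
  have hd : HasFDerivAt φ (fderiv ℝ φ x) x := (hφ.differentiable (by simp) x).hasFDerivAt
  simp only [gram_conformalMetric, Matrix.smul_apply, Matrix.one_apply, smul_eq_mul]
  rw [pd_of_hasFDerivAt i (((hd.const_mul 2).exp).mul_const (if j = l then (1 : ℝ) else 0))]
  split_ifs
  · simp only [pd, one_smul, smul_apply, smul_eq_mul]
    ring
  · simp

theorem christoffel_conformalMetric {n : ℕ} (φ : E n → ℝ) (hφ : ContDiff ℝ ∞ φ)
    (k i j : Fin n) (x : E n) :
    (conformalMetric φ hφ).christoffel k i j x =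
      (if j = k then 1 else 0) * pd i φ x + (if i = k then 1 else 0) * pd j φ x
        - (if i = j then 1 else 0) * pd k φ x := by
  have he : Real.exp (-(2 * φ x)) * Real.exp (2 * φ x) = 1 := by
    rw [← Real.exp_add, neg_add_cancel, Real.exp_zero]
  simp only [Metric.christoffel, inv_gram_conformalMetric, pd_gram_conformalMetric,
    Matrix.smul_apply, Matrix.one_apply, smul_eq_mul, mul_ite, mul_one, mul_zero, ite_mul, zero_mul,
    Finset.sum_ite_eq, Finset.mem_univ, if_true, one_mul]
  split_ifs <;> grind

theorem pd_christoffel_conformalMetric {n : ℕ} (φ : E n → ℝ) (hφ : ContDiff ℝ ∞ φ)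
    (k i j l : Fin n) (x : E n) :
    pd l ((conformalMetric φ hφ).christoffel k i j) x =
      (if j = k then 1 else 0) * pd l (pd i φ) x + (if i = k then 1 else 0) * pd l (pd j φ) x
        - (if i = j then 1 else 0) * pd l (pd k φ) x := by
  have hd (a : Fin n) : HasFDerivAt (pd a φ) (fderiv ℝ (pd a φ) x) x :=
    ((contDiff_pd hφ a).differentiable (by simp) x).hasFDerivAt
  rw [funext (christoffel_conformalMetric φ hφ k i j)]
  refine (pd_of_hasFDerivAt l ((((hd i).const_mul _).add ((hd j).const_mul _)).sub ((hd k).const_mul _))).trans ?_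
  split_ifs <;> simp [pd]

/-- Contracting the deltas, the sum over `m` is `d_j² + d_l² - |d|²` for `j ≠ l` and vanishes for `j
= l`. -/
theorem sum_christoffel_quadratic {n : ℕ} (d : Fin n → ℝ) (G : Fin n → Fin n → Fin n → ℝ)
    (hG : ∀ k i j, G k i j = (if j = k then 1 else 0) * d i + (if i = k then 1 else 0) * d j
        - (if i = j then 1 else 0) * d k) :
    ∑ j, ∑ l, ∑ m, (G l l m * G m j j - G l j m * G m l j) =
      -(((n : ℝ) - 1) * (n - 2)) * ∑ i, d i ^ 2 := by
  have h1 (j l : Fin n) : ∑ m, (G l l m * G m j j - G l j m * G m l j) =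
      2 * d j ^ 2 - ∑ m, d m ^ 2 - d j ^ 2 + d l ^ 2 +
      (if j = l then 1 else 0) * (∑ m, d m ^ 2 - 2 * d j ^ 2) := by
    simp only [hG, add_mul, mul_add, sub_mul, mul_sub, Finset.sum_add_distrib, Finset.sum_sub_distrib,
      ite_mul, mul_ite, one_mul, zero_mul, mul_zero, Finset.sum_ite_eq, Finset.sum_ite_eq',
      Finset.mem_univ, if_true]
    by_cases h : j = l
    · subst h
      simp [Finset.sum_add_distrib]
    · have h' : ¬ l = j := fun e ↦ h e.symm
      simp only [h, h', if_false, pow_two]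
      simp
      ring
  simp only [h1, Finset.sum_add_distrib, Finset.sum_sub_distrib]
  simp [← Finset.mul_sum]
  ring

theorem scalarCurvature_conformalMetric {n : ℕ} (φ : E n → ℝ) (hφ : ContDiff ℝ ∞ φ) (x : E n) :
    (conformalMetric φ hφ).scalarCurvature x = -(((n : ℝ) - 1) * Real.exp (-(2 * φ x)) *
      (2 * ∑ i, pd i (pd i φ) x + (n - 2) * ∑ i, pd i φ x ^ 2)) := by
  have hq := sum_christoffel_quadratic (fun i ↦ pd i φ x)
    (fun k i j ↦ (conformalMetric φ hφ).christoffel k i j x)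
    (fun k i j ↦ christoffel_conformalMetric φ hφ k i j x)
  have hr : (conformalMetric φ hφ).scalarCurvature x =
      Real.exp (-(2 * φ x)) * ∑ j, (conformalMetric φ hφ).ricci j j x := by
    simp [Metric.scalarCurvature, inv_gram_conformalMetric, Matrix.one_apply, Finset.mul_sum]
  rw [hr]
  simp only [Metric.ricci, Metric.riemann, Finset.sum_add_distrib]
  rw [hq]
  simp only [pd_christoffel_conformalMetric, Finset.sum_sub_distrib, Finset.sum_add_distrib]
  simp [← Finset.mul_sum]
  ring

theorem pd_const_mul_log_comp {n : ℕ} {u : E n → ℝ} (hu : ContDiff ℝ ∞ u) (hpos : ∀ x, 0 < u x)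
    (c : ℝ) (i : Fin n) (x : E n) :
    pd i (fun y ↦ c * Real.log (u y)) x = c * (pd i u x / u x) ∧
      pd i (pd i fun y ↦ c * Real.log (u y)) x =
        c * (pd i (pd i u) x / u x - (pd i u x / u x) ^ 2) := by
  have hd (y : E n) : HasFDerivAt u (fderiv ℝ u y) y := (hu.differentiable (by simp) y).hasFDerivAt
  have h1 (y : E n) : pd i (fun y ↦ c * Real.log (u y)) y = c * (pd i u y * (u y)⁻¹) := by
    rw [pd_of_hasFDerivAt i (((hd y).log (hpos y).ne').const_mul c)]
    simp only [pd, smul_apply, smul_eq_mul]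
    ring
  refine ⟨by rw [h1, div_eq_mul_inv], ?_⟩
  have h2 : HasFDerivAt (pd i u) (fderiv ℝ (pd i u) x) x :=
    ((contDiff_pd hu i).differentiable (by simp) x).hasFDerivAt
  have h3 : HasFDerivAt (fun y ↦ (u y)⁻¹) _ x :=
    (hasDerivAt_inv (hpos x).ne').comp_hasFDerivAt x (hd x)
  rw [funext h1]
  refine (pd_of_hasFDerivAt i ((h2.mul h3).const_mul c)).trans ?_
  have := (hpos x).ne'
  simp [pd]
  field_simp
  ring

/-- The factor `2/(n-2)` is the one for which `2Δφ + (n-2)|∇φ|²` loses its gradient terms and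
becomes `(4/(n-2)) Δu/u`. -/
theorem scalarCurvature_nonneg {n : ℕ} (hn : 3 ≤ n) {u : E n → ℝ} (hu : ContDiff ℝ ∞ u)
    (hpos : ∀ x, 0 < u x) (hφ : ContDiff ℝ ∞ fun x ↦ 2 / ((n : ℝ) - 2) * Real.log (u x)) (x : E n)
    (hx : ∑ i, pd i (pd i u) x ≤ 0) : 0 ≤ (conformalMetric _ hφ).scalarCurvature x := by
  have hn' : (3 : ℝ) ≤ n := by exact_mod_cast hn
  rw [scalarCurvature_conformalMetric]
  simp only [fun i ↦ (pd_const_mul_log_comp hu hpos (2 / ((n : ℝ) - 2)) i x).1,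
    fun i ↦ (pd_const_mul_log_comp hu hpos (2 / ((n : ℝ) - 2)) i x).2, mul_pow,
    ← Finset.mul_sum, Finset.sum_sub_distrib, ← Finset.sum_div]
  have h : 2 * (2 / ((n : ℝ) - 2) * ((∑ i, pd i (pd i u) x) / u x - ∑ i, (pd i u x / u x) ^ 2)) +
      (n - 2) * ((2 / ((n : ℝ) - 2)) ^ 2 * ∑ i, (pd i u x / u x) ^ 2) =
      4 / ((n : ℝ) - 2) * ((∑ i, pd i (pd i u) x) / u x) := by
    have : (n : ℝ) - 2 ≠ 0 := by linarith
    field_simp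
    ring
  rw [h, Left.nonneg_neg_iff]
  refine mul_nonpos_of_nonneg_of_nonpos (mul_nonneg (by linarith) (Real.exp_pos _).le) ?_
  exact mul_nonpos_of_nonneg_of_nonpos (div_nonneg (by norm_num) (by linarith))
    (div_nonpos_of_nonpos_of_nonneg hx (hpos x).le)

/-- Working in `s = |x|²` rather than `|x|` avoids any singularity at the origin. -/
theorem sum_pd_pd_radial {n : ℕ} {F : ℝ → ℝ} (hF : ContDiff ℝ ∞ F) (x : E n) :
    ∑ i, pd i (pd i fun y ↦ F (‖y‖ ^ 2)) x =
      2 * n * deriv F (‖x‖ ^ 2) + 4 * ‖x‖ ^ 2 * deriv (deriv F) (‖x‖ ^ 2) := by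
  have hF' : ContDiff ℝ ∞ (deriv F) := (contDiff_infty_iff_deriv.1 hF).2
  have hsq (y : E n) : HasFDerivAt (fun y : E n ↦ ‖y‖ ^ 2) (2 • innerSL ℝ y) y :=
    (hasStrictFDerivAt_norm_sq y).hasFDerivAt
  have hcoord (i : Fin n) (y : E n) : HasFDerivAt (fun y : E n ↦ y i)
      (EuclideanSpace.proj i : E n →L[ℝ] ℝ) y :=
    (EuclideanSpace.proj i : E n →L[ℝ] ℝ).hasFDerivAt
  have h1 (i : Fin n) (y : E n) : pd i (fun y ↦ F (‖y‖ ^ 2)) y = 2 * (deriv F (‖y‖ ^ 2) * y i) := by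
    refine (pd_of_hasFDerivAt i
      (((hF.differentiable (by simp) _).hasDerivAt).comp_hasFDerivAt y (hsq y))).trans ?_
    simp [coordVec, EuclideanSpace.inner_single_right]
    ring
  have h2 (i : Fin n) : pd i (pd i fun y ↦ F (‖y‖ ^ 2)) x =
      2 * deriv F (‖x‖ ^ 2) + 4 * deriv (deriv F) (‖x‖ ^ 2) * x i ^ 2 := by
    have h3 : HasFDerivAt (fun y : E n ↦ deriv F (‖y‖ ^ 2)) _ x :=
      ((hF'.differentiable (by simp) _).hasDerivAt).comp_hasFDerivAt x (hsq x)
    rw [funext (h1 i)]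
    refine (pd_of_hasFDerivAt i ((h3.mul (hcoord i x)).const_mul 2)).trans ?_
    simp [coordVec, EuclideanSpace.inner_single_right]
    ring
  simp only [h2, Finset.sum_add_distrib, ← Finset.mul_sum]
  rw [EuclideanSpace.norm_sq_eq]
  simp
  ring

/-! ### Truncation functions. -/

/-- Integrate a smooth nonincreasing cutoff `θ` that is 1 up to `a/2` and 0 from `a` on. The bound
`ζ t ≤ t` serves the volume estimate. -/
theorem exists_isTruncation {a : ℝ} (ha : 0 < a) :
    ∃ ζ, IsTruncation a ζ ∧ ∀ t, 0 ≤ t → ζ t ≤ t := by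
  set θ : ℝ → ℝ := fun s ↦ Real.smoothTransition (2 - 2 / a * s) with hθ
  have hθs : ContDiff ℝ ∞ θ :=
    Real.smoothTransition.contDiff.comp (contDiff_const.sub (contDiff_const.mul contDiff_id))
  have hanti : Antitone θ := fun s t hst ↦
    Real.smoothTransition.monotone (by gcongr)
  have hint (s t : ℝ) : IntervalIntegrable θ volume s t := hθs.continuous.intervalIntegrable s t
  set ζ : ℝ → ℝ := fun t ↦ ∫ s in (0 : ℝ)..t, θ s with hζ
  have hd (t : ℝ) : HasDerivAt ζ (θ t) t :=
    intervalIntegral.integral_hasDerivAt_right (hint _ _)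
      (hθs.continuous.stronglyMeasurableAtFilter _ _) hθs.continuous.continuousAt
  have hdζ : deriv ζ = θ := funext fun t ↦ (hd t).deriv
  have hle (t : ℝ) (ht : 0 ≤ t) : ζ t ≤ t := by
    have := intervalIntegral.integral_mono_on ht (hint 0 t)
      (intervalIntegrable_const (c := (1 : ℝ))) fun s _ ↦ Real.smoothTransition.le_one _
    simpa using this
  have hconst (t : ℝ) (ht : a ≤ t) : ζ t = ζ a := by
    have h0 : ∫ s in a..t, θ s = 0 := by
      rw [intervalIntegral.integral_congr (g := fun _ ↦ (0 : ℝ))]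
      · simp
      · intro s hs
        rw [Set.uIcc_of_le ht] at hs
        refine Real.smoothTransition.zero_of_nonpos ?_
        have : 2 / a * a ≤ 2 / a * s := by gcongr; exact hs.1
        rw [div_mul_cancel₀ _ ha.ne'] at this
        linarith
    have := intervalIntegral.integral_add_adjacent_intervals (hint 0 a) (hint a t)
    rw [h0, add_zero] at this
    exact this.symm
  refine ⟨ζ, ⟨?_, ?_, ⟨a / 2, by positivity, ?_⟩, ⟨ζ a, hconst⟩, ?_, ?_⟩, hle⟩
  · refine contDiff_infty_iff_deriv.2 ⟨fun t ↦ (hd t).differentiableAt, ?_⟩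
    rw [hdζ]
    exact hθs
  · intro t ht
    refine ⟨intervalIntegral.integral_nonneg ht fun s _ ↦ Real.smoothTransition.nonneg _, ?_⟩
    rcases le_total a t with h | h
    · rw [hconst t h]
      exact hle a ha.le
    · exact (hle t ht).trans h
  · intro t ht
    have : ζ t = ∫ s in (0 : ℝ)..t, (1 : ℝ) := by
      refine intervalIntegral.integral_congr fun s hs ↦ ?_
      rw [Set.uIcc_of_le ht.1] at hs
      refine Real.smoothTransition.one_of_one_le ?_
      have : 2 / a * s ≤ 2 / a * (a / 2) := by gcongr; exact hs.2.trans ht.2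
      have h' : 2 / a * (a / 2) = 1 := by field_simp
      linarith
    simpa using this
  · intro t _
    rw [hdζ]
    exact Real.smoothTransition.nonneg _
  · intro t _
    rw [hdζ]
    exact hanti.deriv_nonpos

theorem IsTruncation.monotoneOn {a : ℝ} {ζ : ℝ → ℝ} (h : IsTruncation a ζ) :
    MonotoneOn ζ (Set.Ici 0) := by
  refine monotoneOn_of_deriv_nonneg (convex_Ici 0) h.smooth.continuous.continuousOn
    (h.smooth.differentiable (by simp)).differentiableOn fun t ht ↦ h.deriv_nonneg t ?_
  exact interior_subset ht

/-- This lower bound gives both the positivity of `u` and the length estimates for completeness. -/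
theorem IsTruncation.exists_min_le {a : ℝ} {ζ : ℝ → ℝ} (h : IsTruncation a ζ) :
    ∃ ε > 0, ∀ t, 0 ≤ t → min t ε ≤ ζ t := by
  obtain ⟨ε, hε, hζ⟩ := h.eq_self
  refine ⟨ε, hε, fun t ht ↦ ?_⟩
  rw [← hζ _ ⟨le_min ht hε.le, min_le_right _ _⟩]
  exact h.monotoneOn (le_min ht hε.le) ht (min_le_left _ _)

/-! ### The radial profile and its superharmonicity. -/

theorem mul_log_pos {r : ℝ} (hr : 1 < r) : 0 < r * Real.log r :=
  mul_pos (by linarith) (Real.log_pos hr)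

theorem profile_pos (n : ℕ) {r : ℝ} (hr : 1 < r) : 0 < profile n r :=
  Real.rpow_pos_of_pos (mul_log_pos hr) _

theorem profile_anti {n : ℕ} (hn : 3 ≤ n) {r s : ℝ} (hr : 1 < r) (hrs : r ≤ s) :
    profile n s ≤ profile n r := by
  have hn' : (3 : ℝ) ≤ n := by exact_mod_cast hn
  refine Real.rpow_le_rpow_of_nonpos (mul_log_pos hr) ?_ (by linarith)
  have := Real.log_pos hr
  gcongr
  linarith

theorem profile_rpow {n : ℕ} (hn : 3 ≤ n) {r : ℝ} (hr : 1 < r) :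
    profile n r ^ (2 / ((n : ℝ) - 2)) = (r * Real.log r)⁻¹ := by
  have hn' : (3 : ℝ) ≤ n := by exact_mod_cast hn
  have h2 : (n : ℝ) - 2 ≠ 0 := by linarith
  rw [profile, ← Real.rpow_mul (mul_log_pos hr).le, ← Real.rpow_neg_one]
  congr 1
  field_simp

/-- The truncated profile as a function of the squared radius. -/
def squareProfile (n : ℕ) (r₀ : ℝ) (ζ : ℝ → ℝ) (s : ℝ) : ℝ :=
  if √s ≤ r₀ then ζ (profile n r₀) else ζ (profile n √s)

theorem squareProfile_of_le {n : ℕ} {r₀ : ℝ} {ζ : ℝ → ℝ} {s : ℝ} (h : √s ≤ r₀) :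
    squareProfile n r₀ ζ s = ζ (profile n r₀) := if_pos h

/-- For `1 < √s ≤ r₀` both arguments of `ζ` lie above the threshold where it becomes constant. The
two formulas thus agree on an open overlap, which gives smoothness across `r₀`. -/
theorem squareProfile_of_one_lt {n : ℕ} (hn : 3 ≤ n) {r₀ : ℝ} {ζ : ℝ → ℝ}
    (hζ : IsTruncation (profile n r₀ / 2) ζ) {s : ℝ} (hs : 1 < s) :
    squareProfile n r₀ ζ s = ζ (profile n √s) := by
  rw [squareProfile]
  split_ifs with h
  · have hs' : 1 < √s := by rwa [Real.lt_sqrt zero_le_one, one_pow]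
    have h1 := profile_pos n (hs'.trans_le h)
    have h2 := profile_anti hn hs' h
    obtain ⟨c, hc⟩ := hζ.eq_const
    rw [hc _ (by linarith), hc _ (by linarith)]
  · rfl

theorem profile_sqrt_eq_exp (n : ℕ) {s : ℝ} (hs : 1 < s) :
    profile n √s = Real.exp (-(((n : ℝ) - 2) / 2) *
      (Real.log s / 2 + Real.log (Real.log s) - Real.log 2)) := by
  have hl := Real.log_pos hs
  have hs' : 1 < √s := by rwa [Real.lt_sqrt zero_le_one, one_pow]
  rw [profile, Real.rpow_def_of_pos (mul_log_pos hs'), Real.log_mul (by positivity)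
    (Real.log_pos hs').ne', Real.log_sqrt (by linarith), Real.log_div hl.ne' two_ne_zero]
  congr 1
  ring

theorem contDiffAt_profile_sqrt (n : ℕ) {s : ℝ} (hs : 1 < s) :
    ContDiffAt ℝ ∞ (fun s ↦ profile n √s) s := by
  have hl := Real.log_pos hs
  have hlog : ContDiffAt ℝ ∞ Real.log s := Real.contDiffAt_log.2 (by linarith)
  have : ContDiffAt ℝ ∞ (fun s ↦ Real.exp (-(((n : ℝ) - 2) / 2) *
      (Real.log s / 2 + Real.log (Real.log s) - Real.log 2))) s :=
    (contDiffAt_const.mul (((hlog.div_const 2).add (hlog.log hl.ne')).sub contDiffAt_const)).exp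
  refine this.congr_of_eventuallyEq ?_
  filter_upwards [lt_mem_nhds hs] with t ht using profile_sqrt_eq_exp n ht

theorem contDiff_squareProfile {n : ℕ} (hn : 3 ≤ n) {r₀ : ℝ} (hr₀ : 1 < r₀) {ζ : ℝ → ℝ}
    (hζ : IsTruncation (profile n r₀ / 2) ζ) : ContDiff ℝ ∞ (squareProfile n r₀ ζ) := by
  rw [contDiff_iff_contDiffAt]
  intro s
  rcases lt_or_ge 1 s with hs | hs
  · refine (hζ.smooth.contDiffAt.comp s (contDiffAt_profile_sqrt n hs)).congr_of_eventuallyEq ?_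
    filter_upwards [lt_mem_nhds hs] with t ht using squareProfile_of_one_lt hn hζ ht
  · refine (contDiffAt_const (c := ζ (profile n r₀))).congr_of_eventuallyEq ?_
    have : s < r₀ ^ 2 := by nlinarith
    filter_upwards [gt_mem_nhds this] with t ht
    exact squareProfile_of_le (Real.sqrt_le_iff.2 ⟨by linarith, ht.le⟩)

/-- The logarithmic derivative of `s ↦ profile n √s`. -/
def logDerivProfile (n : ℕ) (s : ℝ) : ℝ :=
  -(((n : ℝ) - 2) / 2) * (s⁻¹ / 2 + s⁻¹ * (Real.log s)⁻¹)

theorem hasDerivAt_profile_sqrt (n : ℕ) {s : ℝ} (hs : 1 < s) :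
    HasDerivAt (fun s ↦ profile n √s) (profile n √s * logDerivProfile n s) s := by
  have hl := Real.log_pos hs
  have hlog : HasDerivAt Real.log s⁻¹ s := Real.hasDerivAt_log (by linarith)
  have h := ((((hlog.div_const 2).add (hlog.log hl.ne')).sub_const (Real.log 2)).const_mul
    (-(((n : ℝ) - 2) / 2))).exp
  rw [profile_sqrt_eq_exp n hs, logDerivProfile, ← div_eq_mul_inv]
  refine h.congr_of_eventuallyEq ?_
  filter_upwards [lt_mem_nhds hs] with t ht using profile_sqrt_eq_exp n ht

theorem hasDerivAt_logDerivProfile (n : ℕ) {s : ℝ} (hs : 1 < s) :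
    HasDerivAt (logDerivProfile n) ((((n : ℝ) - 2) / 2) *
      ((s⁻¹) ^ 2 * (1 / 2 + (Real.log s)⁻¹ + (Real.log s)⁻¹ ^ 2))) s := by
  have hl := Real.log_pos hs
  have hs0 : s ≠ 0 := by linarith
  have hinv : HasDerivAt (fun s : ℝ ↦ s⁻¹) (-(s ^ 2)⁻¹) s := hasDerivAt_inv hs0
  have hlog : HasDerivAt (fun s ↦ (Real.log s)⁻¹) (-s⁻¹ / (Real.log s) ^ 2) s :=
    (Real.hasDerivAt_log hs0).fun_inv hl.ne'
  have := ((hinv.div_const 2).add (hinv.mul hlog)).const_mul (-(((n : ℝ) - 2) / 2))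
  refine HasDerivAt.congr_deriv this ?_
  field_simp
  ring

/-- With `V = v(√s)`, the `ζ''` part of the Laplacian is nonpositive by concavity, and the `ζ'` part
is `ζ'` times the Laplacian of `V`. -/
theorem laplacian_squareProfile_nonpos {n : ℕ} (hn : 3 ≤ n) {r₀ : ℝ} {ζ : ℝ → ℝ}
    (hζ : IsTruncation (profile n r₀ / 2) ζ) {s : ℝ} (hs : 1 < s) (hs4 : 4 ≤ Real.log s) :
    2 * n * deriv (squareProfile n r₀ ζ) s + 4 * s * deriv (deriv (squareProfile n r₀ ζ)) s ≤ 0 := by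
  have hn' : (3 : ℝ) ≤ n := by exact_mod_cast hn
  have hζ' : ContDiff ℝ ∞ (deriv ζ) := (contDiff_infty_iff_deriv.1 hζ.smooth).2
  have hF (t : ℝ) (ht : 1 < t) : HasDerivAt (squareProfile n r₀ ζ)
      (deriv ζ (profile n √t) * (profile n √t * logDerivProfile n t)) t := by
    have := (hζ.smooth.differentiable (by simp) (profile n √t)).hasDerivAt.comp t
      (hasDerivAt_profile_sqrt n ht)
    refine this.congr_of_eventuallyEq ?_
    filter_upwards [lt_mem_nhds ht] with y hy using squareProfile_of_one_lt hn hζ hy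
  have hζV : HasDerivAt (fun t ↦ deriv ζ (profile n √t))
      (deriv (deriv ζ) (profile n √s) * (profile n √s * logDerivProfile n s)) s :=
    HasDerivAt.comp (h₂ := deriv ζ) s (hζ'.differentiable (by simp) (profile n √s)).hasDerivAt
      (hasDerivAt_profile_sqrt n hs)
  have hF' := hζV.fun_mul
    ((hasDerivAt_profile_sqrt n hs).fun_mul (hasDerivAt_logDerivProfile n hs))
  have he : deriv (squareProfile n r₀ ζ) =ᶠ[nhds s]
      fun t ↦ deriv ζ (profile n √t) * (profile n √t * logDerivProfile n t) := by
    filter_upwards [lt_mem_nhds hs] with t ht using (hF t ht).deriv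
  rw [he.deriv_eq, hF'.deriv, (hF s hs).deriv]
  have hs' : 1 < √s := by rwa [Real.lt_sqrt zero_le_one, one_pow]
  have hV := profile_pos n hs'
  have hz1 := hζ.deriv_nonneg _ hV.le
  have hz2 := hζ.deriv2_nonpos _ hV.le
  set V := profile n √s
  set h := logDerivProfile n s with hh
  set k := (((n : ℝ) - 2) / 2) * ((s⁻¹) ^ 2 * (1 / 2 + (Real.log s)⁻¹ + (Real.log s)⁻¹ ^ 2)) with hk
  -- Here `h = V'/V` and `k = h'`, so this is the Laplacian of `V` divided by `V`. With `L = log s`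
  -- the `1/L` terms cancel, and the sign is that of `2n - (n-2)L²/2`. For `L ≥ 4` this is at most
  -- `2n - 8(n-2)`, negative for all `n ≥ 3`.
  have key : 2 * n * h + 4 * s * (h ^ 2 + k) ≤ 0 := by
    have hs0 : s ≠ 0 := by linarith
    have hl : Real.log s ≠ 0 := by linarith
    have : 2 * n * h + 4 * s * (h ^ 2 + k) = ((n : ℝ) - 2) / 2 * s⁻¹ * ((Real.log s)⁻¹) ^ 2 *
        (2 * n - (n - 2) / 2 * (Real.log s) ^ 2) := by
      rw [hh, hk, logDerivProfile]
      field_simp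
      ring
    rw [this]
    refine mul_nonpos_of_nonneg_of_nonpos ?_ ?_
    · have : 0 ≤ ((n : ℝ) - 2) / 2 := by linarith
      positivity
    · have : (16 : ℝ) ≤ Real.log s ^ 2 := by nlinarith
      nlinarith
  have e1 : deriv (deriv ζ) V * (4 * s * (V * h) ^ 2) ≤ 0 :=
    mul_nonpos_of_nonpos_of_nonneg hz2 (by positivity)
  have e2 : deriv ζ V * V * (2 * n * h + 4 * s * (h ^ 2 + k)) ≤ 0 :=
    mul_nonpos_of_nonneg_of_nonpos (by positivity) key
  refine le_of_eq_of_le ?_ (add_nonpos e1 e2)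
  ring

/-! ### Conformality, completeness and volume. -/

theorem isConformalToEuclidean_conformalMetric {n : ℕ} {u : E n → ℝ} (hpos : ∀ x, 0 < u x)
    (hφ : ContDiff ℝ ∞ fun x ↦ 2 / ((n : ℝ) - 2) * Real.log (u x)) :
    (conformalMetric _ hφ).IsConformalToEuclidean u := by
  intro x v w
  rw [conformalMetric_form, Real.rpow_def_of_pos (hpos x)]
  congr 2
  ring

/-- A function growing like `log log r`, to compare with the radial distance at infinity. -/
def logLogNorm {n : ℕ} (x : E n) : ℝ := Real.log (Real.log (3 + ‖x‖ ^ 2))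

/-- The constant 3 exceeds `e`, which keeps the iterated logarithm smooth and positive even at the
origin. -/
theorem one_lt_log_three_add {n : ℕ} (x : E n) : 1 < Real.log (3 + ‖x‖ ^ 2) := by
  rw [Real.lt_log_iff_exp_lt (by positivity)]
  nlinarith [Real.exp_one_lt_d9, sq_nonneg ‖x‖]

theorem contDiff_logLogNorm {n : ℕ} : ContDiff ℝ 1 (logLogNorm (n := n)) :=
  ((contDiff_const.add (contDiff_norm_sq ℝ)).log fun x ↦ by positivity).log
    fun x ↦ by linarith [one_lt_log_three_add x]

theorem abs_fderiv_logLogNorm_le {n : ℕ} (x v : E n) :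
    |fderiv ℝ logLogNorm x v| ≤
      2 * ‖x‖ / ((3 + ‖x‖ ^ 2) * Real.log (3 + ‖x‖ ^ 2)) * ‖v‖ := by
  have hl := one_lt_log_three_add x
  have hd : HasFDerivAt (logLogNorm (n := n)) _ x :=
    (((hasStrictFDerivAt_norm_sq x).hasFDerivAt.const_add 3).log (by positivity)).log (by linarith)
  rw [hd.fderiv]
  simp only [smul_apply, innerSL_apply_apply, smul_eq_mul, nsmul_eq_mul, abs_mul, abs_inv]
  rw [abs_of_pos (zero_lt_one.trans hl), abs_of_pos (by positivity : 0 < 3 + ‖x‖ ^ 2)]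
  have := abs_real_inner_le_norm x v
  have h0 : 0 < (3 + ‖x‖ ^ 2) * Real.log (3 + ‖x‖ ^ 2) := by positivity
  rw [div_mul_eq_mul_div, le_div_iff₀ h0]
  field_simp
  simp
  linarith

theorem norm_le_of_logLogNorm_le {n : ℕ} {C : ℝ} {x : E n} (h : logLogNorm x ≤ C) :
    ‖x‖ ≤ √(Real.exp (Real.exp C)) := by
  have hl := one_lt_log_three_add x
  rw [logLogNorm, Real.log_le_iff_le_exp (by linarith), Real.log_le_iff_le_exp (by positivity)] at h
  exact Real.le_sqrt_of_sq_le (by linarith)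

theorem logLog_deriv_le_one {r : ℝ} (hl : 1 < Real.log (3 + r ^ 2)) :
    2 * r / ((3 + r ^ 2) * Real.log (3 + r ^ 2)) ≤ 1 := by
  rw [div_le_one (by positivity)]
  nlinarith [sq_nonneg (r - 1)]

theorem logLog_deriv_le {r : ℝ} (hr : 1 < r) :
    2 * r / ((3 + r ^ 2) * Real.log (3 + r ^ 2)) ≤ (r * Real.log r)⁻¹ := by
  have h1 := Real.log_pos hr
  have h2 : 2 * Real.log r ≤ Real.log (3 + r ^ 2) := by
    rw [← Real.log_rpow (by linarith)]
    exact Real.log_le_log (by positivity) (by norm_num)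
  have h0 : 0 < r := by linarith
  calc 2 * r / ((3 + r ^ 2) * Real.log (3 + r ^ 2)) ≤ 2 * r / (r ^ 2 * (2 * Real.log r)) := by
        gcongr
        linarith
    _ = (r * Real.log r)⁻¹ := by field_simp

/-- The hypothesis says that `c * logLogNorm` has `g`-gradient of norm at most 1. -/
theorem isComplete_conformalMetric {n : ℕ} {φ : E n → ℝ} (hφ : ContDiff ℝ ∞ φ) {c : ℝ} (hc : 0 < c)
    (h : ∀ x : E n, c * (2 * ‖x‖ / ((3 + ‖x‖ ^ 2) * Real.log (3 + ‖x‖ ^ 2))) ≤ Real.exp (φ x)) :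
    (conformalMetric φ hφ).IsComplete := by
  refine isComplete_of_proper (fun x ↦ c * logLogNorm x) (contDiff_const.mul contDiff_logLogNorm)
    (fun x v ↦ ?_) fun C ↦ ⟨√(Real.exp (Real.exp (C / c))), fun x hx ↦ ?_⟩
  · rw [fderiv_const_mul (contDiff_logLogNorm.differentiable one_ne_zero x), smul_apply,
      smul_eq_mul, abs_mul, abs_of_pos hc, conformalMetric_form, real_inner_self_eq_norm_sq,
      two_mul, Real.exp_add, ← pow_two, ← mul_pow, Real.sqrt_sq (by positivity)]
    refine (mul_le_mul_of_nonneg_left (abs_fderiv_logLogNorm_le x v) hc.le).trans ?_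
    rw [← mul_assoc]
    exact mul_le_mul_of_nonneg_right (h x) (norm_nonneg v)
  · refine norm_le_of_logLogNorm_le ?_
    rw [le_div_iff₀ hc]
    linarith

theorem integrableOn_inv_mul_inv_log_sq {a : ℝ} (ha : 1 < a) :
    IntegrableOn (fun r ↦ r⁻¹ * (Real.log r ^ 2)⁻¹) (Set.Ioi a) := by
  have hd : ∀ r ∈ Set.Ioi a, HasDerivAt (fun r ↦ -(Real.log r)⁻¹) (r⁻¹ * (Real.log r ^ 2)⁻¹) r := by
    intro r hr
    have hr : 1 < r := ha.trans hr
    have := ((Real.hasDerivAt_log (by linarith : r ≠ 0)).fun_inv (Real.log_pos hr).ne').fun_neg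
    refine this.congr_deriv ?_
    field_simp
  refine integrableOn_Ioi_deriv_of_nonneg (l := 0) ?_ hd ?_ ?_
  · have : ContinuousAt (fun r ↦ -(Real.log r)⁻¹) a :=
      ((Real.continuousAt_log (by linarith)).inv₀ (Real.log_pos ha).ne').neg
    exact this.continuousWithinAt
  · intro r hr
    have : 0 < r := by linarith [hr.out]
    positivity
  · simpa using Real.tendsto_log_atTop.inv_tendsto_atTop.neg

theorem vol_conformalMetric_lt_top {n : ℕ} (hn : 3 ≤ n) {φ : E n → ℝ} (hφ : ContDiff ℝ ∞ φ)
    {r₀ C : ℝ} (hr₀ : 1 ≤ Real.log r₀) (h1 : 1 < r₀) (hin : ∀ x, ‖x‖ ≤ r₀ → Real.exp (φ x) ≤ C)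
    (hout : ∀ x, r₀ ≤ ‖x‖ → Real.exp (φ x) ≤ (‖x‖ * Real.log ‖x‖)⁻¹) :
    (conformalMetric φ hφ).vol Set.univ < ⊤ := by
  have : Nontrivial (E n) := by
    have : Nonempty (Fin n) := ⟨⟨0, by omega⟩⟩
    infer_instance
  -- A radial majorant of the volume density `e^{nφ}`, integrated in polar coordinates.
  set f : ℝ → ℝ := fun r ↦ if r ≤ r₀ then C ^ n else ((r * Real.log r)⁻¹) ^ n with hf
  have hfi : Integrable (fun x : E n ↦ f ‖x‖) := by
    rw [integrable_fun_norm_addHaar (μ := volume) (f := f), finrank_euclideanSpace_fin,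
      ← Set.Ioc_union_Ioi_eq_Ioi (by linarith : (0 : ℝ) ≤ r₀)]
    refine IntegrableOn.union ?_ ?_
    · have : IntegrableOn (fun r : ℝ ↦ r ^ (n - 1) * C ^ n) (Set.Ioc 0 r₀) :=
        (Continuous.integrableOn_Icc (by fun_prop)).mono_set Set.Ioc_subset_Icc_self
      refine this.congr_fun (fun r hr ↦ ?_) measurableSet_Ioc
      simp [hf, hr.2]
    · have hm : AEStronglyMeasurable (fun r : ℝ ↦ r ^ (n - 1) • f r)
          (volume.restrict (Set.Ioi r₀)) := by
        have : Measurable f := Measurable.ite measurableSet_Iic (by fun_prop) (by fun_prop)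
        exact ((measurable_id.pow_const (n - 1)).smul this).aestronglyMeasurable
      refine Integrable.mono' (integrableOn_inv_mul_inv_log_sq h1) hm ?_
      filter_upwards [ae_restrict_mem measurableSet_Ioi] with r hr
      have hr : r₀ < r := hr
      have hr0 : 0 < r := by linarith
      have hl : 1 ≤ Real.log r := hr₀.trans (Real.log_le_log (by linarith) hr.le)
      simp only [hf, not_le.2 hr, if_false, smul_eq_mul]
      rw [Real.norm_of_nonneg (by positivity)]
      obtain ⟨m, rfl⟩ : ∃ m, n = m + 1 := ⟨n - 1, by omega⟩
      have : r ^ (m + 1 - 1) * (r * Real.log r)⁻¹ ^ (m + 1) = r⁻¹ * (Real.log r ^ (m + 1))⁻¹ := by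
        have : Real.log r ≠ 0 := by linarith
        rw [Nat.add_sub_cancel, inv_pow, mul_pow]
        field_simp
        rw [pow_succ]
      rw [this]
      -- Since `log r ≥ 1` and `n ≥ 2`, the power `log^n r` dominates `log² r`.
      gcongr
      omega
  rw [Metric.vol, withDensity_apply _ MeasurableSet.univ, Measure.restrict_univ]
  refine lt_of_le_of_lt (lintegral_mono fun x ↦ ?_) hfi.lintegral_lt_top
  refine ENNReal.ofReal_le_ofReal ?_
  rw [gram_conformalMetric, Matrix.det_smul, Matrix.det_one, mul_one, Fintype.card_fin,
    two_mul, Real.exp_add, mul_pow, Real.sqrt_mul_self (by positivity)]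
  simp only [hf]
  split_ifs with h
  · gcongr
    exact hin x h
  · gcongr
    exact hout x (not_le.1 h).le

theorem liminf_vol_geodBall_div {n : ℕ} {g : Metric n} (hg : g.vol Set.univ < ⊤) (p : E n) :
    liminf (fun r : ℝ ↦ g.vol (g.geodBall p r) / ENNReal.ofReal r) atTop = 0 := by
  refine Tendsto.liminf_eq (tendsto_of_tendsto_of_tendsto_of_le_of_le tendsto_const_nhds
    (h := fun r : ℝ ↦ g.vol Set.univ / ENNReal.ofReal r) ?_ (fun _ ↦ zero_le) fun r ↦ ?_)
  · have := ENNReal.Tendsto.const_div ENNReal.tendsto_ofReal_atTop (Or.inr hg.ne)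
    simpa using this
  · exact ENNReal.div_le_div_right (measure_mono (Set.subset_univ _)) _

/-! ### Assembling the metric. -/

theorem sum_pd_pd_squareProfile_nonpos {n : ℕ} (hn : 3 ≤ n) {r₀ : ℝ} (hr₀ : 1 < r₀)
    (hlog : 2 ≤ Real.log r₀) {ζ : ℝ → ℝ} (hζ : IsTruncation (profile n r₀ / 2) ζ) (x : E n) :
    ∑ i, pd i (pd i fun y ↦ squareProfile n r₀ ζ (‖y‖ ^ 2)) x ≤ 0 := by
  rw [sum_pd_pd_radial (contDiff_squareProfile hn hr₀ hζ)]
  rcases lt_or_ge (‖x‖ ^ 2) (r₀ ^ 2) with h | h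
  · have he : squareProfile n r₀ ζ =ᶠ[nhds (‖x‖ ^ 2)] fun _ ↦ ζ (profile n r₀) := by
      filter_upwards [gt_mem_nhds h] with t ht
      exact squareProfile_of_le (Real.sqrt_le_iff.2 ⟨by linarith, ht.le⟩)
    have he' : deriv (squareProfile n r₀ ζ) =ᶠ[nhds (‖x‖ ^ 2)] fun _ ↦ 0 := by
      simpa using he.deriv
    rw [he'.deriv_eq, he'.eq_of_nhds]
    simp
  · refine laplacian_squareProfile_nonpos hn hζ (by nlinarith) ?_
    have := Real.log_le_log (by positivity) h
    rw [Real.log_pow] at this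
    push_cast at this
    linarith

theorem exists_finite_volume_metric {n : ℕ} (hn : 3 ≤ n) {r₀ : ℝ} (hr₀ : 1 < r₀)
    (hlog : 2 ≤ Real.log r₀) :
    ∃ (g : Metric n) (u : E n → ℝ) (ζ : ℝ → ℝ),
      ContDiff ℝ ∞ u ∧ (∀ x, 0 < u x) ∧ g.IsConformalToEuclidean u ∧
      IsTruncation (profile n r₀ / 2) ζ ∧
      (∀ x, r₀ ≤ ‖x‖ → u x = ζ (profile n ‖x‖)) ∧ (∀ x, ‖x‖ ≤ r₀ → u x = ζ (profile n r₀)) ∧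
      g.IsComplete ∧ (∀ x, 0 ≤ g.scalarCurvature x) ∧ g.vol Set.univ < ⊤ := by
  have hn' : (3 : ℝ) ≤ n := by exact_mod_cast hn
  have hv₀ : 0 < profile n r₀ := profile_pos n hr₀
  obtain ⟨ζ, hζ, hζle⟩ := exists_isTruncation (half_pos hv₀)
  obtain ⟨ε, hε, hmin⟩ := hζ.exists_min_le
  set u : E n → ℝ := fun x ↦ squareProfile n r₀ ζ (‖x‖ ^ 2) with hu
  have hus : ContDiff ℝ ∞ u := (contDiff_squareProfile hn hr₀ hζ).comp (contDiff_norm_sq ℝ)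
  have hin (x : E n) (hx : ‖x‖ ≤ r₀) : u x = ζ (profile n r₀) :=
    squareProfile_of_le (by rwa [Real.sqrt_sq (norm_nonneg x)])
  have hout (x : E n) (hx : r₀ ≤ ‖x‖) : u x = ζ (profile n ‖x‖) := by
    rw [hu]
    simp only
    rw [squareProfile_of_one_lt hn hζ (by nlinarith), Real.sqrt_sq (norm_nonneg x)]
  have hpos (x : E n) : 0 < u x := by
    rcases le_total ‖x‖ r₀ with hx | hx
    · rw [hin x hx]
      exact (lt_min hv₀ hε).trans_le (hmin _ hv₀.le)
    · have := profile_pos n (hr₀.trans_le hx)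
      rw [hout x hx]
      exact (lt_min this hε).trans_le (hmin _ this.le)
  set b : ℝ := 2 / ((n : ℝ) - 2) with hb
  have hb0 : 0 ≤ b := div_nonneg zero_le_two (by linarith)
  have hφ : ContDiff ℝ ∞ fun x ↦ b * Real.log (u x) :=
    contDiff_const.mul (hus.log fun x ↦ (hpos x).ne')
  have hexp (x : E n) : Real.exp (b * Real.log (u x)) = u x ^ b := by
    rw [Real.rpow_def_of_pos (hpos x), mul_comm]
  refine ⟨conformalMetric _ hφ, u, ζ, hus, hpos, isConformalToEuclidean_conformalMetric hpos hφ,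
    hζ, hout, hin, ?_, fun x ↦ scalarCurvature_nonneg hn hus hpos hφ x
      (sum_pd_pd_squareProfile_nonpos hn hr₀ hlog hζ x), ?_⟩
  · set δ := min (profile n r₀) ε with hδ
    have hδ0 : 0 < δ := lt_min hv₀ hε
    have hδb : 0 < δ ^ b := Real.rpow_pos_of_pos hδ0 b
    -- The entry `δ^b` covers the ball and the region `v ≥ ε`, where `u ≥ δ`. The entry 1 covers `v
    -- ≤ ε`, where `u ≥ v` and `v^b = 1/(r log r)`.
    refine isComplete_conformalMetric hφ (c := min 1 (δ ^ b)) (lt_min one_pos hδb) fun x ↦ ?_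
    rw [hexp]
    have hl := one_lt_log_three_add x
    have hD : 0 ≤ 2 * ‖x‖ / ((3 + ‖x‖ ^ 2) * Real.log (3 + ‖x‖ ^ 2)) := by positivity
    have hD1 := logLog_deriv_le_one hl
    have hsmall : min 1 (δ ^ b) * (2 * ‖x‖ / ((3 + ‖x‖ ^ 2) * Real.log (3 + ‖x‖ ^ 2))) ≤ δ ^ b :=
      (mul_le_of_le_one_right (lt_min one_pos hδb).le hD1).trans (min_le_right _ _)
    rcases le_total ‖x‖ r₀ with hx | hx
    · refine hsmall.trans ?_
      rw [hin x hx]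
      exact Real.rpow_le_rpow hδ0.le (hmin _ hv₀.le) hb0
    · have h1 := hr₀.trans_le hx
      have hv := profile_pos n h1
      have hm := hmin _ hv.le
      rw [hout x hx]
      rcases le_total (profile n ‖x‖) ε with h | h
      · rw [min_eq_left h] at hm
        refine le_trans ?_ (Real.rpow_le_rpow hv.le hm hb0)
        rw [profile_rpow hn h1]
        exact (mul_le_of_le_one_left hD (min_le_left _ _)).trans (logLog_deriv_le h1)
      · rw [min_eq_right h] at hm
        exact hsmall.trans (Real.rpow_le_rpow hδ0.le ((min_le_right _ _).trans hm) hb0)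
  · refine vol_conformalMetric_lt_top hn hφ (by linarith) hr₀
      (C := ζ (profile n r₀) ^ b) (fun x hx ↦ ?_) fun x hx ↦ ?_
    · rw [hexp, hin x hx]
    · have h1 := hr₀.trans_le hx
      rw [hexp, ← profile_rpow hn h1]
      refine Real.rpow_le_rpow (hpos x).le ?_ hb0
      rw [hout x hx]
      exact hζle _ (profile_pos n h1).le

end

end FiniteVolume

theorem mainTheorem11 :
    ∃ r₀ : ℝ, 1 < r₀ ∧ ∀ n : ℕ, 3 ≤ n →
      ∃ (g : FiniteVolume.Metric n) (u : FiniteVolume.E n → ℝ) (ζ : ℝ → ℝ),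
        -- the metric is globally conformally flat, with smooth positive conformal factor
        ContDiff ℝ ∞ u ∧ (∀ x, 0 < u x) ∧ g.IsConformalToEuclidean u ∧
        -- the conformal factor is `ζ ∘ (r ln r)^{-(n-2)/2}`, constant in the `r₀`-ball
        FiniteVolume.IsTruncation (FiniteVolume.profile n r₀ / 2) ζ ∧
        (∀ x, r₀ ≤ ‖x‖ → u x = ζ (FiniteVolume.profile n ‖x‖)) ∧
        (∀ x, ‖x‖ ≤ r₀ → u x = ζ (FiniteVolume.profile n r₀)) ∧
        -- complete, nonnegative scalar curvature, finite volume
        g.IsComplete ∧ (∀ x, 0 ≤ g.scalarCurvature x) ∧ g.vol Set.univ < ⊤ ∧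
        -- in particular at least linear volume growth fails
        ∀ p, liminf (fun r : ℝ ↦ g.vol (g.geodBall p r) / ENNReal.ofReal r) atTop = 0 := by
  have h1 : (1 : ℝ) < Real.exp 2 := Real.one_lt_exp_iff.2 two_pos
  -- At `r₀ = e²` one has `log r₀² = 4`, the threshold for superharmonicity in every dimension `n ≥
  -- 3`.
  refine ⟨Real.exp 2, h1, fun n hn ↦ ?_⟩
  obtain ⟨g, u, ζ, hus, hpos, hconf, hζ, hout, hin, hcomplete, hscal, hvol⟩ :=
    FiniteVolume.exists_finite_volume_metric hn h1 (Real.log_exp 2).ge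
  exact ⟨g, u, ζ, hus, hpos, hconf, hζ, hout, hin, hcomplete, hscal, hvol,
    FiniteVolume.liminf_vol_geodBall_div hvol⟩
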